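/- Let $G=(V,E)$ be a finite graph. A \emph{conflict-free $k$-coloring} of $G$ assigns one of $k$ colors to each vertex of some subset of $V$ so that every $v\in V$ has a colored vertex $u$ in its closed neighborhood $N[v]$ whose color occurs only once in $N[v]$. The \emph{conflict-free chromatic number} $\chi_{CF}(G)$ is the least $k$ for which such a coloring exists. By a \emph{convex object} we mean a compact convex subset of $\mathbb{R}^2$ with nonempty interior. In the \emph{intersection graph} of a family of distinct objects, two distinct objects are adjacent if and only if they have a common point. \textbf{Theorem.} (a) For every $n$ there are $n$ distinct convex objects in the plane, with intersection graph $H_n$, such that $$\chi_{CF}(H_n)=\Omega\!\left(\frac{\log n}{\log\log n}\right)\qquad(n\to\infty).$$ (b) Consider the following recursive construction of families of distinct convex objects in the plane with intersection graphs $G_1,G_2,\dots$. The family for $G_1$ is a single object. The family for $G_2$ consists of four objects whose intersection graph is a four-cycle. For $n\ge 3$, take $n$ pairwise intersecting objects (a $K_n$). For each object $v$ of this $K_n$, place two scaled-down copies of the family of $G_{n-1}$, disjoint from each other, into the region covered by $v$ and by no other object of the $K_n$. For each pair $v\neq w$ of objects of the $K_n$, place two scaled-down copies of the family of $G_{n-2}$,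 disjoint from each other, into the region covered by $v$ and $w$ and by no other object of the $K_n$. (A scaled-down copy is an image under a map $p\mapsto b+rp$ with $0<r<1$.) Then: 1. this construction can be carried out with convex objects in the plane for all $n$; 2. however it is carried out, $\chi_{CF}(G_n)=n$ for all $n\ge 1$; 3. the number of vertices satisfies $|G_1|=1$, $|G_2|=4$, $|G_n|=n+2n|G_{n-1}|+n(n-1)|G_{n-2}|$ for $n\ge3$, and $$|G_n|=O\!\left(n!\left(\frac{3+\sqrt{13}}{2}\right)^{n}\right).$$ -/

import Mathlib

/-- The Euclidean plane. -/
abbrev Plane : Type := EuclideanSpace ℝ (Fin 2)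

/-! ### Conflict-free colorings of graphs -/

/-- The closed neighborhood `N[v]` of a vertex. -/
def closedNbhd {V : Type*} (G : SimpleGraph V) (v : V) : Set V :=
  {u | u = v ∨ G.Adj v u}

/-- A partial coloring with `k` colors (`none` means uncolored) is conflict-free if every vertex `v`
has some colored `u` in `N[v]` whose color occurs only once in `N[v]`. -/
def IsConflictFree {V : Type*} (G : SimpleGraph V) {k : ℕ} (χ : V → Option (Fin k)) : Prop :=
  ∀ v, ∃ u ∈ closedNbhd G v, ∃ c : Fin k, χ u = some c ∧
    ∀ w ∈ closedNbhd G v, χ w = some c → w = u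

/-- `G` has a conflict-free `k`-coloring. -/
def ConflictFreeColorable {V : Type*} (G : SimpleGraph V) (k : ℕ) : Prop :=
  ∃ χ : V → Option (Fin k), IsConflictFree G χ

/-- The conflict-free chromatic number of a graph (used for finite graphs only, where the
set below is nonempty). -/
noncomputable def cfChromaticNumber {V : Type*} (G : SimpleGraph V) : ℕ :=
  sInf {k | ConflictFreeColorable G k}

theorem exists_conflictFreeColorable {V : Type*} [Finite V] (G : SimpleGraph V) :
    ∃ k, ConflictFreeColorable G k := by
  obtain ⟨k, ⟨e⟩⟩ := Finite.exists_equiv_fin V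
  refine ⟨k, fun v => some (e v), fun v => ⟨v, Or.inl rfl, e v, rfl, fun w _ hw => ?_⟩⟩
  exact e.injective (Option.some.inj hw)

/-! ### Intersection graphs of convex objects -/

/-- Distinct objects are adjacent if and only if they have a common point. -/
def interGraph {V : Type*} (F : V → Set Plane) : SimpleGraph V where
  Adj u v := u ≠ v ∧ (F u ∩ F v).Nonempty
  symm := ⟨fun u v h => ⟨h.1.symm, by rw [Set.inter_comm]; exact h.2⟩⟩
  loopless := ⟨fun _ h => h.1 rfl⟩

/-- A convex object: a compact convex set with nonempty interior. -/
structure IsConvexObject (A : Set Plane) : Prop where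
  convex : Convex ℝ A
  isCompact : IsCompact A
  interior_nonempty : (interior A).Nonempty

/-- A family of pairwise distinct convex objects in the plane. -/
structure IsConvexFamily {V : Type*} (F : V → Set Plane) : Prop where
  injective : Function.Injective F
  isConvexObject : ∀ v, IsConvexObject (F v)

/-! ### The recursive construction -/

/-- The unordered pairs of distinct elements of `Fin n`. -/
abbrev Pairs (n : ℕ) : Type := {p : Fin n × Fin n // p.1 < p.2}

/-- Index type of one step of the construction: `n` clique objects, then two copies of `α` for
each clique object, then two copies of `β` for each pair of clique objects. -/
abbrev StepIdx (n : ℕ) (α β : Type) : Type :=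
  Fin n ⊕ (Fin n × Fin 2 × α) ⊕ (Pairs n × Fin 2 × β)

/-- The vertex set of `G_n` (`G_0` is an empty dummy; `G_1` is one vertex; `G_2` is a four-cycle). -/
def Idx : ℕ → Type
  | 0 => Empty
  | 1 => Unit
  | 2 => Fin 4
  | n + 3 => StepIdx (n + 3) (Idx (n + 2)) (Idx (n + 1))

instance Idx.instFinite : ∀ n, Finite (Idx n)
  | 0 => inferInstanceAs (Finite Empty)
  | 1 => inferInstanceAs (Finite Unit)
  | 2 => inferInstanceAs (Finite (Fin 4))
  | n + 3 =>
    have := Idx.instFinite (n + 2)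
    have := Idx.instFinite (n + 1)
    inferInstanceAs (Finite (StepIdx (n + 3) (Idx (n + 2)) (Idx (n + 1))))

/-- The part of the plane covered by the objects with index in `S` and by no others. -/
def exactRegion {n : ℕ} (K : Fin n → Set Plane) (S : Set (Fin n)) : Set Plane :=
  {x | ∀ i, x ∈ K i ↔ i ∈ S}

/-- `A'` is a scaled-down copy of the family `A`: its image under `p ↦ b + r • p`, `0 < r < 1`. -/
def IsScaledCopy {α : Type} (A A' : α → Set Plane) : Prop :=
  ∃ (r : ℝ) (b : Plane), 0 < r ∧ r < 1 ∧ ∀ a, A' a = (fun p => b + r • p) '' A a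

/-- `C` arises from `A` and `B` by one step: take `n` pairwise intersecting objects, put two disjoint
scaled-down copies of `A` into the region covered only by `v`, for each of the objects `v`, and two
disjoint scaled-down copies of `B` into the region covered only by `v` and `w`, for each pair. -/
structure IsStep {n : ℕ} {α β : Type} (A : α → Set Plane) (B : β → Set Plane)
    (C : StepIdx n α β → Set Plane) : Prop where
  clique : ∀ v w : Fin n, (C (Sum.inl v) ∩ C (Sum.inl w)).Nonempty
  copy_private : ∀ (v : Fin n) (i : Fin 2),
    IsScaledCopy A (fun a => C (Sum.inr (Sum.inl (v, i, a))))
  private_subset : ∀ (v : Fin n) (i : Fin 2) (a : α),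
    C (Sum.inr (Sum.inl (v, i, a))) ⊆ exactRegion (fun u => C (Sum.inl u)) {v}
  private_disjoint : ∀ (v : Fin n) (a a' : α),
    Disjoint (C (Sum.inr (Sum.inl (v, 0, a)))) (C (Sum.inr (Sum.inl (v, 1, a'))))
  copy_pair : ∀ (p : Pairs n) (i : Fin 2),
    IsScaledCopy B (fun b => C (Sum.inr (Sum.inr (p, i, b))))
  pair_subset : ∀ (p : Pairs n) (i : Fin 2) (b : β),
    C (Sum.inr (Sum.inr (p, i, b))) ⊆ exactRegion (fun u => C (Sum.inl u)) {p.1.1, p.1.2}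
  pair_disjoint : ∀ (p : Pairs n) (b b' : β),
    Disjoint (C (Sum.inr (Sum.inr (p, 0, b)))) (C (Sum.inr (Sum.inr (p, 1, b'))))

/-- `F n` is a family of convex objects with intersection graph `G_n`: one object for `n = 1`,
a four-cycle for `n = 2`, and a step applied to `F (n - 1)` and `F (n - 2)` for `n ≥ 3`. -/
structure IsRecursiveConstruction (F : ∀ n, Idx n → Set Plane) : Prop where
  isConvexFamily : ∀ n, IsConvexFamily (F n)
  two : interGraph (V := Fin 4) (F 2) = SimpleGraph.cycleGraph 4
  step : ∀ n, IsStep (n := n + 3) (F (n + 2)) (F (n + 1)) (F (n + 3))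

/-! ### Conflict-free colorings -/

/-! The upper bound $\chi_{CF}(G_n)\le n$ holds for $n\ge 3$ because the clique dominates $G_n$:
giving its members distinct colors and coloring nothing else is conflict-free.

For the lower bound, suppose $k<n$ colors suffice. If a clique object $v$ is uncolored, both private
copies of $G_{n-1}$ in $v$ find their witnesses internally, so by induction each copy uses all $k$
colors; every color present in $N[v]$ then occurs twice, and $v$ has no witness. If two clique
objects $v,w$ share a color $d$, then $d$ is useless both to $v$ and to the two copies of $G_{n-2}$
in $v\cap w$; by induction each copy uses the other $k-1$ colors, and again $v$ has no witness. So
the clique carries $n$ distinct colors, a contradiction (`IsStep.exists_color_clique`,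
`IsStep.color_clique_ne`).

The construction is realized with thin strips around tangents of a parabola: two tangents meet at a
point off all others, and each touches the parabola off all others (`exists_clique_objects`). The
recursion gives $|G_n|\le n!\,\lambda^n$ with $\lambda^2=3\lambda+1$; inverting this bound and
padding with isolated objects yields $\Omega(\log n/\log\log n)$ for every $n$. -/

theorem cfChromaticNumber_le {V : Type*} {G : SimpleGraph V} {k : ℕ}
    (h : ConflictFreeColorable G k) : cfChromaticNumber G ≤ k :=
  Nat.sInf_le h

theorem le_cfChromaticNumber {V : Type*} [Finite V] {G : SimpleGraph V} {m : ℕ}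
    (h : ∀ k, ConflictFreeColorable G k → m ≤ k) : m ≤ cfChromaticNumber G :=
  h _ (Nat.sInf_mem (exists_conflictFreeColorable G))

/-- If every vertex has a witness whose color lies in `S`, then `S.card` colors suffice. -/
theorem conflictFreeColorable_card {V κ : Type*} {G : SimpleGraph V} (S : Finset κ)
    (χ : V → Option κ)
    (h : ∀ v, ∃ u ∈ closedNbhd G v, ∃ c ∈ S, χ u = some c ∧
      ∀ w ∈ closedNbhd G v, χ w = some c → w = u) :
    ConflictFreeColorable G S.card := by
  classical
  let e := S.equivFin
  let f : κ → Option (Fin S.card) := fun c => if hc : c ∈ S then some (e ⟨c, hc⟩) else none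
  have hf : ∀ c (hc : c ∈ S) c', f c' = some (e ⟨c, hc⟩) → c' = c := by
    intro c hc c' h
    by_cases hc' : c' ∈ S
    · simp only [f, hc', dif_pos, Option.some.injEq, e.injective.eq_iff, Subtype.mk.injEq] at h
      exact h
    · simp [f, hc'] at h
  -- Vertices with colors outside `S` become uncolored; this removes no witness and creates no new
  -- repetition.
  refine ⟨fun v => (χ v).bind f, fun v => ?_⟩
  obtain ⟨u, hu, c, hc, huc, huniq⟩ := h v
  refine ⟨u, hu, e ⟨c, hc⟩, by simp [huc, f, hc], fun w hw hwc => huniq w hw ?_⟩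
  obtain ⟨c', hc', hfc⟩ := Option.bind_eq_some_iff.1 hwc
  rw [hc', hf c hc c' hfc]

theorem mem_closedNbhd_embedding {V W : Type*} {H : SimpleGraph V} {G : SimpleGraph W}
    (f : H ↪g G) {x y : V} : f y ∈ closedNbhd G (f x) ↔ y ∈ closedNbhd H x := by
  simp [closedNbhd]

/-- An induced copy of `H` whose vertices have witnesses inside the copy, with colors in `S`,
uses all the colors of `S` when `H` cannot be colored with fewer than `S.card` colors. -/
theorem exists_color_eq_of_embedding {V W κ : Type*} {H : SimpleGraph V} {G : SimpleGraph W}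
    (f : H ↪g G) (χ : W → Option κ) (S : Finset κ)
    (hH : ∀ k, ConflictFreeColorable H k → S.card ≤ k)
    (h : ∀ x, ∃ u ∈ closedNbhd G (f x), ∃ c ∈ S, u ∈ Set.range f ∧ χ u = some c ∧
      ∀ w ∈ closedNbhd G (f x), χ w = some c → w = u) {c : κ} (hc : c ∈ S) :
    ∃ x, χ (f x) = some c := by
  classical
  -- If `c` were missing from the copy, no witness would have color `c`, and `S.erase c` would
  -- suffice for `H`.
  by_contra! hne
  have := hH _ (conflictFreeColorable_card (G := H) (S.erase c) (fun x => χ (f x)) fun x => by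
    obtain ⟨u, hu, c', hc', ⟨y, rfl⟩, hyc, huniq⟩ := h x
    refine ⟨y, (mem_closedNbhd_embedding f).1 hu, c', ?_, hyc, fun w hw hwc => ?_⟩
    · refine Finset.mem_erase.2 ⟨?_, hc'⟩
      rintro rfl
      exact hne y hyc
    · exact f.injective (huniq _ ((mem_closedNbhd_embedding f).2 hw) hwc))
  have := Finset.card_erase_lt_of_mem hc
  omega

/-- Induced subgraphs without neighbors outside need no more colors. -/
theorem ConflictFreeColorable.of_embedding {V W : Type*} {H : SimpleGraph V} {G : SimpleGraph W}
    (f : H ↪g G) (hf : ∀ x w, G.Adj (f x) w → w ∈ Set.range f) {k : ℕ}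
    (h : ConflictFreeColorable G k) : ConflictFreeColorable H k := by
  obtain ⟨χ, hχ⟩ := h
  refine ⟨fun x => χ (f x), fun x => ?_⟩
  obtain ⟨u, hu, c, huc, huniq⟩ := hχ (f x)
  obtain ⟨y, rfl⟩ : u ∈ Set.range f := by
    rcases hu with rfl | hu
    · exact ⟨x, rfl⟩
    · exact hf x u hu
  exact ⟨y, (mem_closedNbhd_embedding f).1 hu, c, huc, fun w hw hwc =>
    f.injective (huniq _ ((mem_closedNbhd_embedding f).2 hw) hwc)⟩

/-- With one color, every closed neighborhood would contain exactly one colored vertex. Each colored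
vertex lies in three closed neighborhoods, and 3 does not divide 4. The finite check replaces this
count. -/
theorem two_le_of_conflictFreeColorable_cycleGraph {k : ℕ}
    (h : ConflictFreeColorable (SimpleGraph.cycleGraph 4) k) : 2 ≤ k := by
  obtain ⟨χ, hχ⟩ := h
  by_contra hk
  have hk : k = 0 ∨ k = 1 := by omega
  rcases hk with rfl | rfl
  · obtain ⟨u, -, c, -⟩ := hχ 0
    exact c.elim0
  · revert χ
    simp only [IsConflictFree, closedNbhd, Set.mem_ofPred_eq]
    decide

theorem conflictFreeColorable_cycleGraph_two :
    ConflictFreeColorable (SimpleGraph.cycleGraph 4) 2 := by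
  refine ⟨![some 0, none, some 1, none], ?_⟩
  simp only [IsConflictFree, closedNbhd, Set.mem_ofPred_eq]
  decide

/-! ### Conflict-free colorings of the recursive construction -/

theorem eq_of_mem_exactRegion {n : ℕ} {K : Fin n → Set Plane} {S T : Set (Fin n)} {x : Plane}
    (hS : x ∈ exactRegion K S) (hT : x ∈ exactRegion K T) : S = T :=
  Set.ext fun i => (hS i).symm.trans (hT i)

theorem IsScaledCopy.inter_nonempty_iff {α : Type} {A A' : α → Set Plane} (h : IsScaledCopy A A')
    (a b : α) : (A' a ∩ A' b).Nonempty ↔ (A a ∩ A b).Nonempty := by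
  obtain ⟨r, c, hr, -, h⟩ := h
  have hinj : Function.Injective fun p : Plane => c + r • p := fun p q hpq =>
    smul_right_injective _ hr.ne' (add_left_cancel hpq)
  rw [h a, h b, ← Set.image_inter hinj, Set.image_nonempty]

/-- A scaled copy of a family inside another family is an induced copy of the intersection graph. -/
def IsScaledCopy.embedding {α W : Type} {A : α → Set Plane} {C : W → Set Plane} {g : α → W}
    (hg : Function.Injective g) (h : IsScaledCopy A (fun a => C (g a))) :
    interGraph A ↪g interGraph C where
  toFun := g
  inj' := hg
  map_rel_iff' := by
    intro a b
    exact and_congr hg.ne_iff (h.inter_nonempty_iff a b)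

namespace IsStep

variable {n : ℕ} {α β : Type} {A : α → Set Plane} {B : β → Set Plane}
  {C : StepIdx n α β → Set Plane}

theorem adj_clique_private (h : IsStep A B C) (hC : ∀ x, (C x).Nonempty) (v : Fin n) (i : Fin 2)
    (a : α) : (interGraph C).Adj (Sum.inl v) (Sum.inr (Sum.inl (v, i, a))) := by
  obtain ⟨x, hx⟩ := hC (Sum.inr (Sum.inl (v, i, a)))
  exact ⟨by simp, x, (h.private_subset v i a hx v).2 rfl, hx⟩

theorem adj_clique_pair (h : IsStep A B C) (hC : ∀ x, (C x).Nonempty) (p : Pairs n) (i : Fin 2)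
    (b : β) {v : Fin n} (hv : v = p.1.1 ∨ v = p.1.2) :
    (interGraph C).Adj (Sum.inl v) (Sum.inr (Sum.inr (p, i, b))) := by
  obtain ⟨x, hx⟩ := hC (Sum.inr (Sum.inr (p, i, b)))
  exact ⟨by simp, x, (h.pair_subset p i b hx v).2 hv, hx⟩

/-- Exact regions of different index sets are disjoint, so an object inside one meets only the
clique objects covering it and objects placed in the same region; disjointness of the two copies
excludes the other copy. -/
theorem eq_or_eq_of_adj_private (h : IsStep A B C) {v : Fin n} {i : Fin 2} {a : α}
    {u : StepIdx n α β} (hu : (interGraph C).Adj (Sum.inr (Sum.inl (v, i, a))) u) :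
    u = Sum.inl v ∨ ∃ a', u = Sum.inr (Sum.inl (v, i, a')) := by
  obtain ⟨-, x, hx, hxu⟩ := hu
  have hxv := h.private_subset v i a hx
  rcases u with w | ⟨w, j, a'⟩ | ⟨p, j, b⟩
  · left
    rw [show w = v from (hxv w).1 hxu]
  · right
    obtain rfl : v = w :=
      Set.singleton_injective (eq_of_mem_exactRegion hxv (h.private_subset w j a' hxu))
    refine ⟨a', ?_⟩
    have key := h.private_disjoint v
    fin_cases i <;> fin_cases j
    · rfl
    · exact ((key a a').le_bot ⟨hx, hxu⟩).elim
    · exact ((key a' a).le_bot ⟨hxu, hx⟩).elim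
    · rfl
  · have e := eq_of_mem_exactRegion hxv (h.pair_subset p j b hxu)
    have h1 : p.1.1 ∈ ({v} : Set (Fin n)) := e ▸ Or.inl rfl
    have h2 : p.1.2 ∈ ({v} : Set (Fin n)) := e ▸ Or.inr rfl
    exact absurd (h1.trans h2.symm) p.2.ne

theorem eq_or_eq_of_adj_pair (h : IsStep A B C) {p : Pairs n} {i : Fin 2} {b : β}
    {u : StepIdx n α β} (hu : (interGraph C).Adj (Sum.inr (Sum.inr (p, i, b))) u) :
    (u = Sum.inl p.1.1 ∨ u = Sum.inl p.1.2) ∨ ∃ b', u = Sum.inr (Sum.inr (p, i, b')) := by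
  obtain ⟨-, x, hx, hxu⟩ := hu
  have hxp := h.pair_subset p i b hx
  rcases u with w | ⟨w, j, a⟩ | ⟨q, j, b'⟩
  · left
    rcases (hxp w).1 hxu with hw | hw
    · exact Or.inl (congrArg _ hw)
    · exact Or.inr (congrArg _ hw)
  · have e := eq_of_mem_exactRegion (h.private_subset w j a hxu) hxp
    have h1 : p.1.1 ∈ ({w} : Set (Fin n)) := e ▸ Or.inl rfl
    have h2 : p.1.2 ∈ ({w} : Set (Fin n)) := e ▸ Or.inr rfl
    exact absurd (h1.trans h2.symm) p.2.ne
  · right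
    have e := eq_of_mem_exactRegion hxp (h.pair_subset q j b' hxu)
    obtain rfl : p = q := by
      obtain ⟨⟨p1, p2⟩, hp⟩ := p
      obtain ⟨⟨q1, q2⟩, hq⟩ := q
      rcases Set.pair_eq_pair_iff.1 e with ⟨h1, h2⟩ | ⟨h1, h2⟩ <;> simp only at hp hq h1 h2
      · simp [h1, h2]
      · subst h1 h2
        exact absurd hp hq.asymm
    refine ⟨b', ?_⟩
    have key := h.pair_disjoint p
    fin_cases i <;> fin_cases j
    · rfl
    · exact ((key b b').le_bot ⟨hx, hxu⟩).elim
    · exact ((key b' b).le_bot ⟨hxu, hx⟩).elim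
    · rfl

/-- Coloring the clique objects with distinct colors is conflict-free. -/
theorem conflictFreeColorable (h : IsStep A B C) (hC : ∀ x, (C x).Nonempty) :
    ConflictFreeColorable (interGraph C) n := by
  have key : ∀ (w : StepIdx n α β) (c : Fin n),
      (Sum.elim some (fun _ => none) w : Option (Fin n)) = some c → w = Sum.inl c := by
    rintro (w | w) c hw
    · exact congrArg _ (Option.some.inj hw)
    · simp at hw
  refine ⟨Sum.elim some (fun _ => none), ?_⟩
  rintro (v | ⟨v, i, a⟩ | ⟨p, i, b⟩)
  · exact ⟨_, Or.inl rfl, v, rfl, fun w _ => key w v⟩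
  · exact ⟨Sum.inl v, Or.inr (h.adj_clique_private hC v i a).symm, v, rfl, fun w _ => key w v⟩
  · exact ⟨Sum.inl p.1.1, Or.inr (h.adj_clique_pair hC p i b (Or.inl rfl)).symm, p.1.1, rfl,
      fun w _ => key w _⟩

/-- In a conflict-free coloring with fewer than `n` colors every clique object is colored. -/
theorem exists_color_clique (h : IsStep A B C) (hC : ∀ x, (C x).Nonempty)
    (hA : ∀ k, ConflictFreeColorable (interGraph A) k → n - 1 ≤ k) {k : ℕ} (hk : k < n)
    {χ : StepIdx n α β → Option (Fin k)} (hχ : IsConflictFree (interGraph C) χ) (v : Fin n) :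
    ∃ c, χ (Sum.inl v) = some c := by
  by_contra! hv
  obtain ⟨u, -, c, -, huniq⟩ := hχ (Sum.inl v)
  -- The only outside neighbor of the copy is `v`, which is uncolored, so all witnesses are
  -- internal. As the copy needs `n - 1 ≥ k` colors, it uses every color, in particular `c`.
  have key : ∀ i : Fin 2, ∃ a, χ (Sum.inr (Sum.inl (v, i, a))) = some c := by
    intro i
    refine exists_color_eq_of_embedding (IsScaledCopy.embedding (C := C)
      (g := fun a => Sum.inr (Sum.inl (v, i, a))) (fun a b hab => by simpa using hab)
      (h.copy_private v i)) χ Finset.univ (fun j hj => ?_) (fun a => ?_) (Finset.mem_univ c)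
    · have := hA j hj
      rw [Finset.card_univ, Fintype.card_fin]
      omega
    · obtain ⟨u, hu, c, huc, huniq⟩ := hχ (Sum.inr (Sum.inl (v, i, a)))
      refine ⟨u, hu, c, Finset.mem_univ c, ?_, huc, huniq⟩
      rcases hu with rfl | hu
      · exact ⟨a, rfl⟩
      · rcases h.eq_or_eq_of_adj_private hu with rfl | ⟨a', rfl⟩
        · exact absurd huc (hv c)
        · exact ⟨a', rfl⟩
  obtain ⟨a, ha⟩ := key 0
  obtain ⟨a', ha'⟩ := key 1
  have := (huniq _ (Or.inr (h.adj_clique_private hC v 0 a)) ha).trans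
    (huniq _ (Or.inr (h.adj_clique_private hC v 1 a')) ha').symm
  simp at this

/-- In a conflict-free coloring with fewer than `n` colors no two clique objects have the same
color. -/
theorem color_clique_ne (h : IsStep A B C) (hC : ∀ x, (C x).Nonempty)
    (hB : ∀ k, ConflictFreeColorable (interGraph B) k → n - 2 ≤ k) {k : ℕ} (hk : k < n)
    {χ : StepIdx n α β → Option (Fin k)} (hχ : IsConflictFree (interGraph C) χ) (p : Pairs n)
    {d : Fin k} (h1 : χ (Sum.inl p.1.1) = some d) : χ (Sum.inl p.1.2) ≠ some d := by
  intro h2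
  have hne : (Sum.inl p.1.1 : StepIdx n α β) ≠ Sum.inl p.1.2 := fun e => p.2.ne (Sum.inl.inj e)
  obtain ⟨u, -, c, -, huniq⟩ := hχ (Sum.inl p.1.1)
  have hcd : c ≠ d := by
    rintro rfl
    exact hne ((huniq _ (Or.inl rfl) h1).trans
      (huniq _ (Or.inr ⟨hne, h.clique p.1.1 p.1.2⟩) h2).symm)
  -- Both clique objects of color `d` are adjacent to the whole copy, so no witness there has color
  -- `d` and all are internal. The `k - 1 ≤ n - 2` other colors must all be used, including `c`.
  have key : ∀ i : Fin 2, ∃ b, χ (Sum.inr (Sum.inr (p, i, b))) = some c := by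
    intro i
    refine exists_color_eq_of_embedding (IsScaledCopy.embedding (C := C)
      (g := fun b => Sum.inr (Sum.inr (p, i, b))) (fun a b hab => by simpa using hab)
      (h.copy_pair p i)) χ (Finset.univ.erase d) (fun j hj => ?_) (fun b => ?_)
      (Finset.mem_erase.2 ⟨hcd, Finset.mem_univ c⟩)
    · have := hB j hj
      rw [Finset.card_erase_of_mem (Finset.mem_univ d), Finset.card_univ, Fintype.card_fin]
      omega
    · obtain ⟨u, hu, c, huc, huniq⟩ := hχ (Sum.inr (Sum.inr (p, i, b)))
      have hcd : c ≠ d := by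
        rintro rfl
        exact hne ((huniq _ (Or.inr (h.adj_clique_pair hC p i b (Or.inl rfl)).symm) h1).trans
          (huniq _ (Or.inr (h.adj_clique_pair hC p i b (Or.inr rfl)).symm) h2).symm)
      refine ⟨u, hu, c, Finset.mem_erase.2 ⟨hcd, Finset.mem_univ c⟩, ?_, huc, huniq⟩
      rcases hu with rfl | hu
      · exact ⟨b, rfl⟩
      · rcases h.eq_or_eq_of_adj_pair hu with (rfl | rfl) | ⟨b', rfl⟩
        · exact absurd (Option.some.inj (huc.symm.trans h1)) hcd
        · exact absurd (Option.some.inj (huc.symm.trans h2)) hcd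
        · exact ⟨b', rfl⟩
  obtain ⟨b, hb⟩ := key 0
  obtain ⟨b', hb'⟩ := key 1
  have := (huniq _ (Or.inr (h.adj_clique_pair hC p 0 b (Or.inl rfl))) hb).trans
    (huniq _ (Or.inr (h.adj_clique_pair hC p 1 b' (Or.inl rfl))) hb').symm
  simp at this

/-- Pigeonhole: `n` clique objects cannot all be colored, with pairwise distinct colors, from fewer
than `n` colors. -/
theorem le_of_conflictFreeColorable (h : IsStep A B C) (hC : ∀ x, (C x).Nonempty)
    (hA : ∀ k, ConflictFreeColorable (interGraph A) k → n - 1 ≤ k)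
    (hB : ∀ k, ConflictFreeColorable (interGraph B) k → n - 2 ≤ k) {k : ℕ}
    (hk : ConflictFreeColorable (interGraph C) k) : n ≤ k := by
  obtain ⟨χ, hχ⟩ := hk
  by_contra! hkn
  choose c hc using h.exists_color_clique hC hA hkn hχ
  obtain ⟨v, w, hvw, hcvw⟩ := Fintype.exists_ne_map_eq_of_card_lt c (by simpa using hkn)
  rcases lt_or_gt_of_ne hvw with hlt | hlt
  · exact h.color_clique_ne hC hB hkn hχ ⟨(v, w), hlt⟩ (hc v) (hcvw ▸ hc w)
  · exact h.color_clique_ne hC hB hkn hχ ⟨(w, v), hlt⟩ (hc w) (hcvw ▸ hc v)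

end IsStep

namespace IsRecursiveConstruction

variable {F : ∀ n, Idx n → Set Plane}

theorem nonempty (hF : IsRecursiveConstruction F) (n : ℕ) (x : Idx n) : (F n x).Nonempty :=
  (((hF.isConvexFamily n).isConvexObject x).interior_nonempty).mono interior_subset

theorem le_of_conflictFreeColorable (hF : IsRecursiveConstruction F) : ∀ (n : ℕ) {k : ℕ},
    ConflictFreeColorable (interGraph (F n)) k → n ≤ k
  | 0, _, _ => Nat.zero_le _
  | 1, k, ⟨_, hχ⟩ => by
    obtain ⟨-, -, c, -⟩ := hχ ()
    exact Nat.one_le_iff_ne_zero.2 fun hk => (hk ▸ c).elim0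
  | 2, _, h => two_le_of_conflictFreeColorable_cycleGraph (hF.two ▸ h)
  | n + 3, _, h => (hF.step n).le_of_conflictFreeColorable (hF.nonempty (n + 3))
      (fun _ hk => le_of_conflictFreeColorable hF (n + 2) hk)
      (fun _ hk => le_of_conflictFreeColorable hF (n + 1) hk) h

theorem conflictFreeColorable (hF : IsRecursiveConstruction F) : ∀ n, 1 ≤ n →
    ConflictFreeColorable (interGraph (F n)) n
  | 1, _ => ⟨fun _ => some 0, fun v => ⟨v, Or.inl rfl, 0, rfl, fun _ _ _ => rfl⟩⟩
  | 2, _ => by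
    have h := conflictFreeColorable_cycleGraph_two
    rw [← hF.two] at h
    exact h
  | n + 3, _ => (hF.step n).conflictFreeColorable (hF.nonempty (n + 3))

theorem cfChromaticNumber_eq (hF : IsRecursiveConstruction F) {n : ℕ} (hn : 1 ≤ n) :
    cfChromaticNumber (interGraph (F n)) = n :=
  le_antisymm (cfChromaticNumber_le (hF.conflictFreeColorable n hn))
    (le_cfChromaticNumber fun _ => hF.le_of_conflictFreeColorable n)

end IsRecursiveConstruction

/-! ### Convex objects and scaled copies -/

theorem IsConvexObject.nonempty {A : Set Plane} (hA : IsConvexObject A) : A.Nonempty :=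
  hA.interior_nonempty.mono interior_subset

/-- The map `p ↦ b + r • p` as a homeomorphism. -/
noncomputable def scaleHomeomorph (r : ℝ) (hr : r ≠ 0) (b : Plane) : Plane ≃ₜ Plane :=
  (Homeomorph.smulOfNeZero r hr).trans (Homeomorph.addLeft b)

theorem IsConvexObject.scale {A : Set Plane} (hA : IsConvexObject A) {r : ℝ} (hr : r ≠ 0)
    (b : Plane) : IsConvexObject ((fun p => b + r • p) '' A) where
  convex := by
    have := (hA.convex.smul r).translate b
    rwa [← Set.image_smul, Set.image_image] at this
  isCompact := hA.isCompact.image (scaleHomeomorph r hr b).continuous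
  interior_nonempty := by
    have := (scaleHomeomorph r hr b).image_interior A
    change (interior (scaleHomeomorph r hr b '' A)).Nonempty
    rw [← this]
    exact hA.interior_nonempty.image _

theorem isConvexObject_closedBall (c : Plane) {R : ℝ} (hR : 0 < R) :
    IsConvexObject (Metric.closedBall c R) where
  convex := convex_closedBall c R
  isCompact := isCompact_closedBall c R
  interior_nonempty := by
    rw [interior_closedBall c hR.ne']
    exact ⟨c, Metric.mem_ball_self hR⟩

theorem IsConvexFamily.exists_subset_ball {V : Type*} [Finite V] {A : V → Set Plane}
    (hA : IsConvexFamily A) : ∃ R, 0 < R ∧ ∀ a, A a ⊆ Metric.ball 0 R := by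
  have : Bornology.IsBounded (⋃ a, A a) :=
    (Bornology.isBounded_iUnion).2 fun a => (hA.isConvexObject a).isCompact.isBounded
  obtain ⟨R, hR⟩ := this.subset_ball 0
  exact ⟨max R 1, by positivity, fun a => ((Set.subset_iUnion A a).trans hR).trans
    (Metric.ball_subset_ball (le_max_left _ _))⟩

theorem IsConvexFamily.exists_isScaledCopy {α : Type} [Finite α] {A : α → Set Plane}
    (hA : IsConvexFamily A) {U : Set Plane} (hU : IsOpen U) (hne : U.Nonempty) :
    ∃ D : α → Set Plane, IsScaledCopy A D ∧ ∀ a, D a ⊆ U := by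
  obtain ⟨c, hc⟩ := hne
  obtain ⟨ε, hε, hεU⟩ := Metric.isOpen_iff.1 hU c hc
  obtain ⟨R, hR, hAR⟩ := hA.exists_subset_ball
  -- The bound `1 / 2` keeps the ratio below 1; `ε / R` shrinks the ball of radius `R` into the ball
  -- of radius `ε`.
  have hr : 0 < min (1 / 2) (ε / R) := by positivity
  refine ⟨fun a => (fun p => c + min (1 / 2) (ε / R) • p) '' A a,
    ⟨_, c, hr, (min_le_left _ _).trans_lt (by norm_num), fun _ => rfl⟩, fun a => ?_⟩
  rintro - ⟨p, hp, rfl⟩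
  have hp := mem_ball_zero_iff.1 (hAR a hp)
  apply hεU
  rw [mem_ball_iff_norm, add_sub_cancel_left, norm_smul, Real.norm_of_nonneg hr.le]
  calc min (1 / 2) (ε / R) * ‖p‖ < min (1 / 2) (ε / R) * R := by gcongr
    _ ≤ ε / R * R := by gcongr; exact min_le_right _ _
    _ = ε := div_mul_cancel₀ _ hR.ne'

theorem IsConvexFamily.exists_two_isScaledCopy {α : Type} [Finite α] {A : α → Set Plane}
    (hA : IsConvexFamily A) {U : Set Plane} (hU : IsOpen U) (hne : U.Nonempty) :
    ∃ D : Fin 2 → α → Set Plane, (∀ i, IsScaledCopy A (D i)) ∧ (∀ i a, D i a ⊆ U) ∧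
      ∀ a a', Disjoint (D 0 a) (D 1 a') := by
  obtain ⟨x, hx⟩ := hne
  have hinf : U.Infinite := infinite_of_mem_nhds x (hU.mem_nhds hx)
  obtain ⟨y, hy, hyx⟩ := hinf.nontrivial.exists_ne x
  obtain ⟨V, W, hV, hW, hyV, hxW, hVW⟩ := t2_separation hyx
  obtain ⟨D, hD, hDU⟩ := hA.exists_isScaledCopy (hU.inter hV) ⟨y, hy, hyV⟩
  obtain ⟨E, hE, hEU⟩ := hA.exists_isScaledCopy (hU.inter hW) ⟨x, hx, hxW⟩
  refine ⟨![D, E], ?_, ?_, fun a a' => ?_⟩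
  · exact Fin.forall_fin_two.2 ⟨hD, hE⟩
  · exact Fin.forall_fin_two.2 ⟨fun a => (hDU a).trans Set.inter_subset_left,
      fun a => (hEU a).trans Set.inter_subset_left⟩
  · exact hVW.mono ((hDU a).trans Set.inter_subset_right) ((hEU a').trans Set.inter_subset_right)

/-- The part of a disk that lies in a strip. -/
def diskStrip (R : ℝ) (f : Plane →L[ℝ] ℝ) (a b : ℝ) : Set Plane :=
  Metric.closedBall 0 R ∩ f ⁻¹' Set.Icc a b

theorem mem_interior_diskStrip {R : ℝ} {f : Plane →L[ℝ] ℝ} {a b : ℝ} {p : Plane}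
    (hp : p ∈ Metric.ball 0 R) (hf : f p ∈ Set.Ioo a b) : p ∈ interior (diskStrip R f a b) :=
  interior_maximal (Set.inter_subset_inter Metric.ball_subset_closedBall
    (Set.preimage_mono Set.Ioo_subset_Icc_self))
    (Metric.isOpen_ball.inter (isOpen_Ioo.preimage f.continuous)) ⟨hp, hf⟩

theorem isClosed_diskStrip (R : ℝ) (f : Plane →L[ℝ] ℝ) (a b : ℝ) :
    IsClosed (diskStrip R f a b) :=
  Metric.isClosed_closedBall.inter (isClosed_Icc.preimage f.continuous)

theorem isConvexObject_diskStrip {R : ℝ} {f : Plane →L[ℝ] ℝ} {a b : ℝ} {p : Plane}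
    (hp : p ∈ Metric.ball 0 R) (hf : f p ∈ Set.Ioo a b) :
    IsConvexObject (diskStrip R f a b) where
  convex := (convex_closedBall 0 R).inter ((convex_Icc a b).linear_preimage f.toLinearMap)
  isCompact := (isCompact_closedBall 0 R).inter_right (isClosed_Icc.preimage f.continuous)
  interior_nonempty := ⟨p, mem_interior_diskStrip hp hf⟩

/-! ### Clique objects: strips around tangents of a parabola -/

/-- The linear part of the equation `y - 2 t x + t ^ 2 = 0` of a tangent of a parabola. -/
noncomputable def tangentForm (t : ℝ) : Plane →L[ℝ] ℝ :=
  EuclideanSpace.proj (1 : Fin 2) - (2 * t) • EuclideanSpace.proj (0 : Fin 2)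

/-- The common point of the tangents with parameters `s` and `t`. -/
noncomputable def tangentPoint (s t : ℝ) : Plane := !₂[(s + t) / 2, s * t]

/-- The offset `(u - s) * (u - t)` from the tangent `u` vanishes for `u = s` or `u = t`, and for
other integer parameters has absolute value at least 1. Hence strips of half-width `1 / 4` at
integer parameters separate these points. -/
theorem tangentForm_tangentPoint (u s t : ℝ) :
    tangentForm u (tangentPoint s t) = -u ^ 2 + (u - s) * (u - t) := by
  simp [tangentForm, tangentPoint]
  ring

/-- A strip around a tangent of a parabola, cut off by a disk. -/
noncomputable def tangentStrip (R t : ℝ) : Set Plane :=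
  diskStrip R (tangentForm t) (-t ^ 2 - 1 / 4) (-t ^ 2 + 1 / 4)

theorem tangentForm_tangentPoint_mem {u s t : ℝ} (h : u = s ∨ u = t) :
    tangentForm u (tangentPoint s t) ∈ Set.Ioo (-u ^ 2 - 1 / 4) (-u ^ 2 + 1 / 4) := by
  rw [tangentForm_tangentPoint, mul_eq_zero.2 (h.imp sub_eq_zero.2 sub_eq_zero.2)]
  constructor <;> linarith

theorem tangentPoint_notMem_tangentStrip (R : ℝ) {u s t : ℕ} (hs : u ≠ s) (ht : u ≠ t) :
    tangentPoint s t ∉ tangentStrip R u := by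
  rintro ⟨-, h⟩
  rw [Set.mem_preimage, tangentForm_tangentPoint] at h
  have h1 : 1 ≤ |((u : ℤ) - s) * (u - t)| := Int.one_le_abs (mul_ne_zero (by omega) (by omega))
  have h2 : (1 : ℝ) ≤ |((u : ℝ) - s) * (u - t)| := by exact_mod_cast h1
  have h3 : |((u : ℝ) - s) * (u - t)| ≤ 1 / 4 := abs_le.2 ⟨by linarith [h.1], by linarith [h.2]⟩
  linarith

theorem exists_tangentPoint_mem_ball (n : ℕ) :
    ∃ R, ∀ i j : Fin n, tangentPoint (i : ℕ) (j : ℕ) ∈ Metric.ball (0 : Plane) R := by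
  have h := (Set.finite_range fun p : Fin n × Fin n =>
    tangentPoint (p.1 : ℕ) (p.2 : ℕ)).isBounded.subset_ball 0
  obtain ⟨R, hR⟩ := h
  exact ⟨R, fun i j => hR ⟨(i, j), rfl⟩⟩

theorem tangentPoint_mem_interior_exactRegion {n : ℕ} {R : ℝ} (i j : Fin n)
    (hR : tangentPoint (i : ℕ) (j : ℕ) ∈ Metric.ball (0 : Plane) R) :
    tangentPoint (i : ℕ) (j : ℕ) ∈
      interior (exactRegion (fun k : Fin n => tangentStrip R (k : ℕ)) {i, j}) := by
  -- A finite intersection of open sets inside the exact region: interiors of the two chosen strips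
  -- and complements of the other strips, which are closed.
  let O : Fin n → Set Plane := fun k =>
    if k = i ∨ k = j then interior (tangentStrip R (k : ℕ)) else (tangentStrip R (k : ℕ))ᶜ
  have hO : IsOpen (⋂ k, O k) := isOpen_iInter_of_finite fun k => by
    by_cases hk : k = i ∨ k = j
    · simp only [O, hk, if_true]
      exact isOpen_interior
    · simp only [O, hk, if_false]
      exact (isClosed_diskStrip _ _ _ _).isOpen_compl
  have hsub : ⋂ k, O k ⊆ exactRegion (fun k : Fin n => tangentStrip R (k : ℕ)) {i, j} := by
    intro x hx k
    have hk := Set.mem_iInter.1 hx k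
    by_cases h : k = i ∨ k = j
    · simp only [O, h, if_true] at hk
      exact iff_of_true (interior_subset hk) h
    · simp only [O, h, if_false] at hk
      exact iff_of_false hk h
  refine interior_maximal hsub hO (Set.mem_iInter.2 fun k => ?_)
  by_cases h : k = i ∨ k = j
  · simp only [O, h, if_true]
    exact mem_interior_diskStrip hR
      (tangentForm_tangentPoint_mem (h.imp (fun e => by rw [e]) fun e => by rw [e]))
  · simp only [O, h, if_false]
    rw [not_or] at h
    exact tangentPoint_notMem_tangentStrip R (fun e => h.1 (Fin.ext e))
      fun e => h.2 (Fin.ext e)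

/-- The case `v = w`, where the tangent point lies on the parabola, supplies the private regions; `v
≠ w` supplies the pair regions and the pairwise intersections. -/
theorem exists_clique_objects (n : ℕ) :
    ∃ K : Fin n → Set Plane, (∀ v, IsConvexObject (K v)) ∧
      (∀ v w, (interior (exactRegion K {v, w})).Nonempty) := by
  obtain ⟨R, hR⟩ := exists_tangentPoint_mem_ball n
  exact ⟨fun k => tangentStrip R (k : ℕ),
    fun v => isConvexObject_diskStrip (hR v v) (tangentForm_tangentPoint_mem (Or.inl rfl)),
    fun v w => ⟨_, tangentPoint_mem_interior_exactRegion v w (hR v w)⟩⟩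

/-! ### Carrying out the construction -/

theorem IsScaledCopy.isConvexObject {α : Type} {A A' : α → Set Plane} (h : IsScaledCopy A A')
    (hA : IsConvexFamily A) (a : α) : IsConvexObject (A' a) := by
  obtain ⟨r, b, hr, -, h⟩ := h
  rw [h a]
  exact (hA.isConvexObject a).scale hr.ne' b

theorem IsScaledCopy.injective {α : Type} {A A' : α → Set Plane} (h : IsScaledCopy A A')
    (hA : IsConvexFamily A) : Function.Injective A' := by
  obtain ⟨r, b, hr, -, h⟩ := h
  intro x y hxy
  rw [h x, h y] at hxy
  exact hA.injective ((scaleHomeomorph r hr.ne' b).injective.image_injective hxy)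

theorem exists_isStep {n : ℕ} (hn : 2 ≤ n) {α β : Type} [Finite α] [Finite β] {A : α → Set Plane}
    {B : β → Set Plane} (hA : IsConvexFamily A) (hB : IsConvexFamily B) :
    ∃ C : StepIdx n α β → Set Plane, IsConvexFamily C ∧ IsStep A B C := by
  obtain ⟨K, hK, hKne⟩ := exists_clique_objects n
  choose D hD hDsub hDdisj using fun v =>
    hA.exists_two_isScaledCopy isOpen_interior (hKne v v)
  choose E hE hEsub hEdisj using fun p : Pairs n =>
    hB.exists_two_isScaledCopy isOpen_interior (hKne p.1.1 p.1.2)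
  let C : StepIdx n α β → Set Plane :=
    Sum.elim K (Sum.elim (fun x => D x.1 x.2.1 x.2.2) fun x => E x.1 x.2.1 x.2.2)
  have hstep : IsStep A B C :=
    { clique := fun v w => by
        obtain ⟨x, hx⟩ := (hKne v w).mono interior_subset
        exact ⟨x, (hx v).2 (Or.inl rfl), (hx w).2 (Or.inr rfl)⟩
      copy_private := hD
      private_subset := fun v i a => by
        have := (hDsub v i a).trans interior_subset
        rwa [Set.pair_eq_singleton] at this
      private_disjoint := hDdisj
      copy_pair := hE
      pair_subset := fun p i b => (hEsub p i b).trans interior_subset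
      pair_disjoint := hEdisj }
  have hobj : ∀ x, IsConvexObject (C x) := by
    rintro (v | ⟨v, i, a⟩ | ⟨p, i, b⟩)
    · exact hK v
    · exact (hD v i).isConvexObject hA a
    · exact (hE p i).isConvexObject hB b
  have hne : ∀ x, (C x).Nonempty := fun x => (hobj x).nonempty
  -- Equal objects with different indices would be adjacent, so for placed objects distinctness need
  -- only be checked within one copy and against the clique.
  have hadj : ∀ {x y}, C x = C y → x ≠ y → (interGraph C).Adj x y := fun {x y} h hxy =>
    ⟨hxy, by rw [← h, Set.inter_self]; exact hne x⟩
  -- `K v` contains points covered by it alone and points shared with another `K u`, hence lies in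
  -- no single exact region. This needs `2 ≤ n`.
  have hsub : ∀ (v : Fin n) (S : Set (Fin n)), ¬ K v ⊆ exactRegion K S := by
    intro v S hS
    have : Nontrivial (Fin n) := Fin.nontrivial_iff_two_le.2 hn
    obtain ⟨u, hu⟩ := exists_ne v
    obtain ⟨x, hx⟩ := (hKne v v).mono interior_subset
    obtain ⟨y, hy⟩ := (hKne v u).mono interior_subset
    have h1 := eq_of_mem_exactRegion hx (hS ((hx v).2 (Or.inl rfl)))
    have h2 := eq_of_mem_exactRegion hy (hS ((hy v).2 (Or.inl rfl)))
    have h3 : u ∈ ({v, v} : Set (Fin n)) := h1.trans h2.symm ▸ Or.inr rfl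
    exact hu (h3.elim id id)
  refine ⟨C, ⟨?_, hobj⟩, hstep⟩
  rintro (v | ⟨v, i, a⟩ | ⟨p, i, b⟩) y hxy
  · rcases y with w | ⟨w, i, a⟩ | ⟨p, i, b⟩
    · obtain ⟨x, hx⟩ := (hKne v v).mono interior_subset
      have hv : x ∈ K v := (hx v).2 (Or.inl rfl)
      have hxy : K v = K w := hxy
      rw [show w = v from ((hx w).1 (hxy ▸ hv)).elim id id]
    · exact (hsub v _ (hxy.subset.trans (hstep.private_subset w i a))).elim
    · exact (hsub v _ (hxy.subset.trans (hstep.pair_subset p i b))).elim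
  · by_contra hne'
    rcases hstep.eq_or_eq_of_adj_private (hadj hxy hne') with rfl | ⟨a', rfl⟩
    · exact hsub v _ (hxy.symm.subset.trans (hstep.private_subset v i a))
    · exact hne' (congrArg _ (congrArg _ (congrArg _ (congrArg _ ((hD v i).injective hA hxy)))))
  · by_contra hne'
    rcases hstep.eq_or_eq_of_adj_pair (hadj hxy hne') with (rfl | rfl) | ⟨b', rfl⟩
    · exact hsub p.1.1 _ (hxy.symm.subset.trans (hstep.pair_subset p i b))
    · exact hsub p.1.2 _ (hxy.symm.subset.trans (hstep.pair_subset p i b))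
    · exact hne' (congrArg _ (congrArg _ (congrArg _ (congrArg _ ((hE p i).injective hB hxy)))))

/-- Four strips, parallel to the sides of a square. -/
noncomputable def squareStrip (i : Fin 4) : Set Plane :=
  diskStrip 10 (EuclideanSpace.proj (![0, 1, 0, 1] i)) (![0, 0, 2, 2] i) (![1, 1, 3, 3] i)

theorem mem_ball_ten {x y : ℝ} (hx : x ∈ Set.Icc (0 : ℝ) 3) (hy : y ∈ Set.Icc (0 : ℝ) 3) :
    (!₂[x, y] : Plane) ∈ Metric.ball (0 : Plane) 10 := by
  rw [mem_ball_zero_iff, EuclideanSpace.norm_eq, Real.sqrt_lt' (by norm_num)]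
  simp only [Fin.sum_univ_two, Real.norm_eq_abs, sq_abs]
  have h1 : x ^ 2 ≤ 3 ^ 2 := pow_le_pow_left₀ hx.1 hx.2 2
  have h2 : y ^ 2 ≤ 3 ^ 2 := pow_le_pow_left₀ hy.1 hy.2 2
  simp only [Matrix.cons_val_zero, Matrix.cons_val_one]
  linarith

theorem interGraph_squareStrip : interGraph squareStrip = SimpleGraph.cycleGraph 4 := by
  have hpt : ∀ (i j : Fin 4) (x y : ℝ), x ∈ Set.Icc (0 : ℝ) 3 → y ∈ Set.Icc (0 : ℝ) 3 →
      (![x, y] (![0, 1, 0, 1] i) ∈ Set.Icc (![0, 0, 2, 2] i : ℝ) (![1, 1, 3, 3] i)) →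
      (![x, y] (![0, 1, 0, 1] j) ∈ Set.Icc (![0, 0, 2, 2] j : ℝ) (![1, 1, 3, 3] j)) →
      (squareStrip i ∩ squareStrip j).Nonempty := fun i j x y hx hy hi hj =>
    have hb := Metric.ball_subset_closedBall (mem_ball_ten hx hy)
    ⟨!₂[x, y], ⟨hb, hi⟩, hb, hj⟩
  have h01 : (squareStrip 0 ∩ squareStrip 1).Nonempty := by
    refine hpt 0 1 0 0 ?_ ?_ ?_ ?_ <;> simp
  have h12 : (squareStrip 1 ∩ squareStrip 2).Nonempty := by
    refine hpt 1 2 2 0 ?_ ?_ ?_ ?_ <;> simp <;> norm_num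
  have h23 : (squareStrip 2 ∩ squareStrip 3).Nonempty := by
    refine hpt 2 3 2 2 ?_ ?_ ?_ ?_ <;> simp <;> norm_num
  have h30 : (squareStrip 3 ∩ squareStrip 0).Nonempty := by
    refine hpt 3 0 0 2 ?_ ?_ ?_ ?_ <;> simp <;> norm_num
  have h02 : ¬ (squareStrip 0 ∩ squareStrip 2).Nonempty := by
    rintro ⟨p, ⟨-, -, h1⟩, -, h2, -⟩
    simp at h1 h2
    linarith
  have h13 : ¬ (squareStrip 1 ∩ squareStrip 3).Nonempty := by
    rintro ⟨p, ⟨-, -, h1⟩, -, h2, -⟩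
    simp at h1 h2
    linarith
  have hcyc : ∀ i j : Fin 4, (SimpleGraph.cycleGraph 4).Adj i j ↔
      i ≠ j ∧ ¬ (i = 0 ∧ j = 2 ∨ i = 2 ∧ j = 0 ∨ i = 1 ∧ j = 3 ∨ i = 3 ∧ j = 1) := by decide
  ext i j
  rw [hcyc]
  refine and_congr_right fun _ => ?_
  have hcomm := fun i j => Set.inter_comm (squareStrip i) (squareStrip j)
  have h10 := hcomm 0 1 ▸ h01
  have h21 := hcomm 1 2 ▸ h12
  have h32 := hcomm 2 3 ▸ h23
  have h03 := hcomm 3 0 ▸ h30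
  have h20 := hcomm 0 2 ▸ h02
  have h31 := hcomm 1 3 ▸ h13
  clear hpt hcyc hcomm
  fin_cases i <;> fin_cases j <;> simp_all

theorem isConvexObject_squareStrip (i : Fin 4) : IsConvexObject (squareStrip i) := by
  have hpt : ∀ x ∈ Set.Icc (0 : ℝ) 3,
      x ∈ Set.Ioo (![0, 0, 2, 2] i : ℝ) (![1, 1, 3, 3] i) → IsConvexObject (squareStrip i) :=
    fun x hx hi => isConvexObject_diskStrip (mem_ball_ten hx hx) (by
      have : (!₂[x, x] : Plane) (![0, 1, 0, 1] i) = x := by fin_cases i <;> rfl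
      change (!₂[x, x] : Plane) (![0, 1, 0, 1] i) ∈ _
      rwa [this])
  fin_cases i
  · exact hpt (1 / 2) (by norm_num) (by norm_num)
  · exact hpt (1 / 2) (by norm_num) (by norm_num)
  · exact hpt (5 / 2) (by norm_num) (by norm_num)
  · exact hpt (5 / 2) (by norm_num) (by norm_num)

theorem isConvexFamily_squareStrip : IsConvexFamily squareStrip where
  injective := by
    intro i j hij
    by_contra hne
    have hadj : (interGraph squareStrip).Adj i j :=
      ⟨hne, by rw [← hij, Set.inter_self]; exact (isConvexObject_squareStrip i).nonempty⟩
    -- Equal objects meet the same objects, but a four-cycle has no two adjacent vertices with the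
    -- same closed neighborhood.
    have hcyc : ∀ i j, (SimpleGraph.cycleGraph 4).Adj i j → ∃ k, k ≠ j ∧
        (SimpleGraph.cycleGraph 4).Adj i k ∧ ¬ (SimpleGraph.cycleGraph 4).Adj j k := by decide
    rw [← interGraph_squareStrip] at hcyc
    obtain ⟨k, hkj, hik, hjk⟩ := hcyc i j hadj
    exact hjk ⟨hkj.symm, hij ▸ hik.2⟩
  isConvexObject := isConvexObject_squareStrip

/-- Families of convex objects that carry out the recursive construction. -/
noncomputable def recursiveFamily : ∀ n, {F : Idx n → Set Plane // IsConvexFamily F}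
  | 0 => ⟨fun x => Empty.elim x, fun x => Empty.elim x, fun x => Empty.elim x⟩
  | 1 => ⟨fun _ => Metric.closedBall 0 1, fun _ _ _ => rfl,
      fun _ => isConvexObject_closedBall 0 one_pos⟩
  | 2 => ⟨squareStrip, isConvexFamily_squareStrip⟩
  | n + 3 =>
    have h := exists_isStep (show 2 ≤ n + 3 by omega) (recursiveFamily (n + 2)).2 (recursiveFamily (n + 1)).2
    ⟨h.choose, h.choose_spec.1⟩

theorem isRecursiveConstruction_recursiveFamily :
    IsRecursiveConstruction fun n => (recursiveFamily n).1 where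
  isConvexFamily n := (recursiveFamily n).2
  two := interGraph_squareStrip
  step n := (exists_isStep (show 2 ≤ n + 3 by omega) (recursiveFamily (n + 2)).2
    (recursiveFamily (n + 1)).2).choose_spec.2

/-! ### The number of vertices -/

theorem card_pairs (n : ℕ) : Nat.card (Pairs n) * 2 = n * (n - 1) := by
  let e : Pairs n ≃ (j : Fin n) × Fin (j : ℕ) :=
    { toFun := fun p => ⟨p.1.2, ⟨p.1.1, p.2⟩⟩
      invFun := fun x => ⟨(⟨x.2, x.2.2.trans x.1.2⟩, x.1), x.2.2⟩
      left_inv := fun _ => rfl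
      right_inv := fun _ => rfl }
  rw [Nat.card_congr e, Nat.card_sigma]
  simp only [Nat.card_fin]
  rw [Fin.sum_univ_eq_sum_range (fun i => i), Finset.sum_range_id_mul_two]

theorem card_stepIdx (n : ℕ) (α β : Type) [Finite α] [Finite β] :
    Nat.card (StepIdx n α β) = n + 2 * n * Nat.card α + n * (n - 1) * Nat.card β := by
  rw [← card_pairs, Nat.card_sum, Nat.card_sum, Nat.card_prod, Nat.card_prod, Nat.card_prod,
    Nat.card_prod, Nat.card_fin, Nat.card_fin]
  ring

theorem card_idx_add_three (n : ℕ) : Nat.card (Idx (n + 3)) =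
    (n + 3) + 2 * (n + 3) * Nat.card (Idx (n + 2)) + (n + 3) * (n + 2) * Nat.card (Idx (n + 1)) :=
  card_stepIdx (n + 3) (Idx (n + 2)) (Idx (n + 1))

theorem card_idx_one : Nat.card (Idx 1) = 1 := Nat.card_unique (α := Unit)

theorem card_idx_two : Nat.card (Idx 2) = 4 := Nat.card_fin 4

/-- Dividing by $n!$, $a_n=|G_n|/n!$ satisfies $a_n=1/(n-1)!+2a_{n-1}+a_{n-2}$. Absorbing the first
term into a third copy of the bound on $a_{n-1}$ leads to $\lambda^2=3\lambda+1$. -/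
theorem card_idx_le : ∀ n : ℕ,
    (Nat.card (Idx n) : ℝ) ≤ n.factorial * ((3 + Real.sqrt 13) / 2) ^ n
  | 0 => by
    rw [show Nat.card (Idx 0) = 0 from Nat.card_of_isEmpty (α := Empty)]
    simp
  | 1 => by
    rw [card_idx_one]
    have := Real.sqrt_nonneg 13
    norm_num
    linarith
  | 2 => by
    rw [card_idx_two]
    have := Real.sqrt_nonneg 13
    norm_num [Nat.factorial]
    nlinarith
  | n + 3 => by
    have h1 := card_idx_le (n + 1)
    have h2 := card_idx_le (n + 2)
    have hs := Real.sqrt_nonneg 13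
    have hl : ((3 + Real.sqrt 13) / 2) ^ 2 = 3 * ((3 + Real.sqrt 13) / 2) + 1 := by
      have := Real.sq_sqrt (show (0 : ℝ) ≤ 13 by norm_num)
      nlinarith
    have hl1 : 1 ≤ (3 + Real.sqrt 13) / 2 := by linarith
    generalize (3 + Real.sqrt 13) / 2 = l at *
    rw [card_idx_add_three]
    push_cast [Nat.factorial_succ] at h1 h2 ⊢
    have hf : (1 : ℝ) ≤ n.factorial := by exact_mod_cast n.factorial_pos
    have hp : 1 ≤ l ^ (n + 2) := one_le_pow₀ hl1
    -- The bound for index `n + 2` is at least 1, so the summand `n + 3` costs at most one more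
    -- multiple of it, turning the coefficient 2 into 3.
    have hq : (1 : ℝ) ≤ (n + 1 + 1) * ((n + 1) * n.factorial) * l ^ (n + 2) := by
      have hn : (0 : ℝ) ≤ n := n.cast_nonneg
      have h1 : (1 : ℝ) ≤ (n + 1) * n.factorial := one_le_mul_of_one_le_of_one_le (by linarith) hf
      exact one_le_mul_of_one_le_of_one_le
        (one_le_mul_of_one_le_of_one_le (by linarith) h1) hp
    calc ((n : ℝ) + 3) + 2 * (n + 3) * Nat.card (Idx (n + 2))
          + (n + 3) * (n + 2) * Nat.card (Idx (n + 1))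
        ≤ ((n : ℝ) + 3) * ((n + 1 + 1) * ((n + 1) * n.factorial) * l ^ (n + 2))
          + 2 * (n + 3) * ((n + 1 + 1) * ((n + 1) * n.factorial) * l ^ (n + 2))
          + (n + 3) * (n + 2) * ((n + 1) * n.factorial * l ^ (n + 1)) := by
          gcongr
          exact le_mul_of_one_le_right (by positivity) hq
      _ = (n + 2 + 1) * ((n + 1 + 1) * ((n + 1) * n.factorial)) * (l ^ (n + 1) * (3 * l + 1)) := by
          ring
      _ = (n + 2 + 1) * ((n + 1 + 1) * ((n + 1) * n.factorial)) * l ^ (n + 3) := by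
          rw [← hl]
          ring

/-! ### Adding objects that meet no others -/

/-- The added objects must avoid the old ones: $\chi_{CF}$ is not monotone under induced subgraphs,
since a single dominating vertex lowers it to 1. -/
theorem exists_pad {V : Type} [Finite V] {F : V → Set Plane} (hF : IsConvexFamily F) (k : ℕ) :
    ∃ C : V ⊕ Fin k → Set Plane, IsConvexFamily C ∧ (∀ v, C (Sum.inl v) = F v) ∧
      ∀ v i, Disjoint (C (Sum.inl v)) (C (Sum.inr i)) := by
  obtain ⟨R, hR, hFR⟩ := hF.exists_subset_ball
  -- Unit disks around these centers lie in the half-plane where the first coordinate is at least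
  -- `R`, outside the open ball containing the family.
  let c : Fin k → Plane := fun i => !₂[R + 1 + 3 * (i : ℕ), 0]
  have hc0 : ∀ i, ∀ p ∈ Metric.closedBall (c i) 1, |p 0 - (R + 1 + 3 * (i : ℕ))| ≤ 1 := by
    intro i p hp
    have h := (PiLp.norm_apply_le (p - c i) 0).trans (mem_closedBall_iff_norm.1 hp)
    simpa [c] using h
  have hdisj : ∀ v i, Disjoint (F v) (Metric.closedBall (c i) 1) := by
    refine fun v i => Set.disjoint_left.2 fun p hp hpi => ?_
    have h1 := (PiLp.norm_apply_le p 0).trans_lt (mem_ball_zero_iff.1 (hFR v hp))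
    rw [Real.norm_eq_abs] at h1
    have h2 := abs_le.1 (hc0 i p hpi)
    have h3 := abs_lt.1 h1
    have h4 : (0 : ℝ) ≤ (i : ℕ) := Nat.cast_nonneg _
    linarith [h2.1, h3.2]
  refine ⟨Sum.elim F fun i => Metric.closedBall (c i) 1, ⟨?_, ?_⟩, fun _ => rfl, hdisj⟩
  · have hne : ∀ v i, F v ≠ Metric.closedBall (c i) 1 := fun v i h => by
      obtain ⟨p, hp⟩ := (hF.isConvexObject v).nonempty
      exact Set.disjoint_left.1 (hdisj v i) hp (h ▸ hp)
    refine hF.injective.sumElim (fun i j hij => ?_) hne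
    have hmem : c i ∈ Metric.closedBall (c j) 1 := by
      rw [← show Metric.closedBall (c i) 1 = Metric.closedBall (c j) 1 from hij]
      exact Metric.mem_closedBall_self zero_le_one
    have h := hc0 j _ hmem
    have h2 : |(3 * ((i : ℕ) - (j : ℕ)) : ℤ)| ≤ 1 := by
      have : (|(3 * ((i : ℕ) - (j : ℕ)) : ℝ)|) ≤ 1 := by
        convert h using 2
        simp [c]
        ring
      exact_mod_cast this
    rw [abs_le] at h2
    exact Fin.ext (by omega)
  · rintro (v | i)
    · exact hF.isConvexObject v
    · exact isConvexObject_closedBall _ one_pos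

theorem IsConvexFamily.comp_equiv {V W : Type*} {F : V → Set Plane} (hF : IsConvexFamily F)
    (e : W ≃ V) : IsConvexFamily (F ∘ e) :=
  ⟨hF.injective.comp e.injective, fun w => hF.isConvexObject (e w)⟩

/-- A family of at most `n` convex objects can be enlarged to `n` convex objects without
decreasing the conflict-free chromatic number. -/
theorem exists_family_of_card_le {V : Type} [Finite V] {F : V → Set Plane}
    (hF : IsConvexFamily F) {m n : ℕ} (hm : ∀ k, ConflictFreeColorable (interGraph F) k → m ≤ k)
    (hn : Nat.card V ≤ n) :
    ∃ D : Fin n → Set Plane, IsConvexFamily D ∧ m ≤ cfChromaticNumber (interGraph D) := by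
  obtain ⟨C, hC, hCF, hdisj⟩ := exists_pad hF (n - Nat.card V)
  have hcard : Nat.card (V ⊕ Fin (n - Nat.card V)) = n := by
    rw [Nat.card_sum, Nat.card_fin]
    omega
  let e : Fin n ≃ V ⊕ Fin (n - Nat.card V) := (Finite.equivFinOfCardEq hcard).symm
  refine ⟨C ∘ e, hC.comp_equiv e, le_cfChromaticNumber fun k hk => hm k ?_⟩
  let f : interGraph F ↪g interGraph (C ∘ e) :=
    { toFun := fun v => e.symm (Sum.inl v)
      inj' := e.symm.injective.comp Sum.inl_injective
      map_rel_iff' := by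
        intro a b
        simp [interGraph, hCF] }
  refine ConflictFreeColorable.of_embedding f (fun x w hw => ?_) hk
  obtain ⟨-, p, hp, hpw⟩ := hw
  obtain ⟨w, rfl⟩ := e.symm.surjective w
  rcases w with v | i
  · exact ⟨v, rfl⟩
  · change p ∈ C (e (e.symm (Sum.inl x))) at hp
    rw [e.apply_symm_apply] at hp
    rw [Function.comp_apply, e.apply_symm_apply] at hpw
    exact (Set.disjoint_left.1 (hdisj x i) hp hpw).elim

/-! ### Asymptotics -/

/-- Since $\lambda\le 4$, $n\le(4(m+1))^{m+1}$. If $4(m+1)\le\log n$, then $\log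
n\le(m+1)\log(4(m+1))\le(m+1)\log\log n$; otherwise $\log n\le 4(m+1)$ already suffices. The
constant 8 comes from $m+1\le 2m$. -/
theorem log_div_log_log_le {n m : ℕ} (hm : 1 ≤ m) (hn : 1 ≤ Real.log (Real.log n))
    (hnm : (n : ℝ) ≤ (m + 1).factorial * ((3 + Real.sqrt 13) / 2) ^ (m + 1)) :
    Real.log n / Real.log (Real.log n) ≤ 8 * m := by
  have hm' : (1 : ℝ) ≤ m := by exact_mod_cast hm
  have hL0 : 0 ≤ Real.log n := Real.log_natCast_nonneg n
  have hL : 0 < Real.log n := hL0.lt_of_ne' fun h => by norm_num [h] at hn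
  have hn0 : (0 : ℝ) < n := (Nat.cast_nonneg n).lt_of_ne' fun h => by simp [h] at hL
  rw [div_le_iff₀ (by linarith)]
  rcases le_total (4 * ((m : ℝ) + 1)) (Real.log n) with h | h
  · have hs : Real.sqrt 13 ≤ 5 := Real.sqrt_le_iff.2 (by norm_num)
    have hs0 := Real.sqrt_nonneg 13
    have hle : (n : ℝ) ≤ (4 * (m + 1)) ^ (m + 1) := by
      calc (n : ℝ) ≤ (m + 1).factorial * ((3 + Real.sqrt 13) / 2) ^ (m + 1) := hnm
        _ ≤ (m + 1) ^ (m + 1) * 4 ^ (m + 1) := by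
          gcongr
          · exact_mod_cast (m + 1).factorial_le_pow
          · linarith
        _ = (4 * (m + 1)) ^ (m + 1) := by rw [← mul_pow, mul_comm]
    calc Real.log n ≤ Real.log ((4 * (m + 1)) ^ (m + 1)) := Real.log_le_log hn0 hle
      _ = (m + 1) * Real.log (4 * (m + 1)) := by rw [Real.log_pow]; push_cast; rfl
      _ ≤ (8 * m) * Real.log (Real.log n) := by
        have h0 : 0 ≤ Real.log (4 * ((m : ℝ) + 1)) := Real.log_nonneg (by linarith)
        gcongr
        linarith
  · calc Real.log n ≤ 8 * m * 1 := by linarith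
      _ ≤ 8 * m * Real.log (Real.log n) := by gcongr

theorem exists_family_log_le (n : ℕ) :
    ∃ D : Fin n → Set Plane, IsConvexFamily D ∧ (1 ≤ Real.log (Real.log n) →
      Real.log n / Real.log (Real.log n) ≤ 8 * cfChromaticNumber (interGraph D)) := by
  have hF := isRecursiveConstruction_recursiveFamily
  rcases Nat.eq_zero_or_pos n with rfl | hn
  -- With `Real.log 0 = 0` the hypothesis reads `1 ≤ 0`.
  · exact ⟨fun i => i.elim0, ⟨fun i => i.elim0, fun i => i.elim0⟩, fun h => by norm_num at h⟩
  have hle : ∀ m, m ≤ Nat.card (Idx m) := by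
    rintro (_ | _ | _ | m)
    · simp
    · exact card_idx_one.ge
    · rw [card_idx_two]; norm_num
    · rw [card_idx_add_three]; exact (Nat.le_add_right _ _).trans (Nat.le_add_right _ _)
  -- `m + 1` is the least index whose family has more than `n` objects, so `G_m` fits into `n`
  -- objects while the size bound at `m + 1` controls `n`.
  obtain ⟨m, hm1, hmn, hnm⟩ : ∃ m, 1 ≤ m ∧ Nat.card (Idx m) ≤ n ∧ n < Nat.card (Idx (m + 1)) := by
    classical
    have hex : ∃ m, n < Nat.card (Idx m) := ⟨n + 1, hle (n + 1)⟩
    have hspec := Nat.find_spec hex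
    have h1 : 2 ≤ Nat.find hex := by
      rw [Nat.le_find_iff]
      intro m hm
      interval_cases m
      · rw [show Nat.card (Idx 0) = 0 from Nat.card_of_isEmpty (α := Empty)]; omega
      · rw [card_idx_one]; omega
    refine ⟨Nat.find hex - 1, by omega, not_lt.1 (Nat.find_min hex (by omega)), ?_⟩
    rwa [Nat.sub_add_cancel (by omega)]
  obtain ⟨D, hD, hmD⟩ := exists_family_of_card_le (hF.isConvexFamily m)
    (fun _ => hF.le_of_conflictFreeColorable m) hmn
  refine ⟨D, hD, fun h => (log_div_log_log_le hm1 h ?_).trans (by gcongr)⟩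
  exact (Nat.cast_le.2 hnm.le).trans (card_idx_le (m + 1))

theorem mainTheorem5 :
    -- for every `n` there are `n` convex objects, with conflict-free number in Ω(log n / log log n)
    (∃ F : ∀ n : ℕ, Fin n → Set Plane, (∀ n, IsConvexFamily (F n)) ∧
      (fun n : ℕ => Real.log n / Real.log (Real.log n)) =O[Filter.atTop]
        (fun n : ℕ => (cfChromaticNumber (interGraph (F n)) : ℝ))) ∧
    -- the recursive construction can be carried out with convex objects in the plane
    (∃ F : ∀ n, Idx n → Set Plane, IsRecursiveConstruction F) ∧
    -- however it is carried out, `G_n` needs exactly `n` colors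
    (∀ F : ∀ n, Idx n → Set Plane, IsRecursiveConstruction F →
      ∀ n, 1 ≤ n → cfChromaticNumber (interGraph (F n)) = n) ∧
    -- the number of vertices
    (Nat.card (Idx 1) = 1 ∧ Nat.card (Idx 2) = 4 ∧
      ∀ n, 3 ≤ n → Nat.card (Idx n) =
        n + 2 * n * Nat.card (Idx (n - 1)) + n * (n - 1) * Nat.card (Idx (n - 2))) ∧
    (fun n : ℕ => (Nat.card (Idx n) : ℝ)) =O[Filter.atTop]
      (fun n : ℕ => (n.factorial : ℝ) * ((3 + Real.sqrt 13) / 2) ^ n) := by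

  refine ⟨?_, ⟨_, isRecursiveConstruction_recursiveFamily⟩,
    fun F hF n hn => hF.cfChromaticNumber_eq hn, ⟨card_idx_one, card_idx_two, ?_⟩, ?_⟩
  · choose D hD hlog using exists_family_log_le
    refine ⟨D, hD, Asymptotics.IsBigO.of_bound 8 ?_⟩
    have htend : Filter.Tendsto (fun n : ℕ => Real.log (Real.log n)) Filter.atTop Filter.atTop :=
      Real.tendsto_log_atTop.comp (Real.tendsto_log_atTop.comp tendsto_natCast_atTop_atTop)
    filter_upwards [htend.eventually_ge_atTop 1] with n hn
    rw [Real.norm_of_nonneg (div_nonneg (Real.log_natCast_nonneg n) (by linarith)),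
      Real.norm_of_nonneg (Nat.cast_nonneg _)]
    exact hlog n hn
  · intro n hn
    obtain ⟨k, rfl⟩ := Nat.exists_eq_add_of_le' hn
    exact card_idx_add_three k
  · refine Asymptotics.IsBigO.of_bound 1 (Filter.Eventually.of_forall fun n => ?_)
    rw [one_mul, Real.norm_of_nonneg (Nat.cast_nonneg _)]
    exact (card_idx_le n).trans (le_abs_self _)
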